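/- Let $n$ be a positive integer, $[n]=\{1,\dots,n\}$, and let $\lambda$ be a partition with at most $n$ parts, whose Young diagram has columns $1,\dots,\lambda_1$ of lengths $c_1\ge\dots\ge c_{\lambda_1}$. Let $T$ be a semistandard tableau of shape $\lambda$ with values in $[n]$ (rows weakly increase, columns strictly increase downwards); $T(j,i)$ is its value in column $j$ and row $i$, and $C_j$ is its $j$-th column. A semistandard tableau is a *key* if each value of a column also occurs in the column immediately to its left. *Key of a permutation.* For a permutation $\phi$ of $[n]$, $Y_\lambda(\phi)$ is the key of shape $\lambda$ whose $j$-th column consists of $\phi_1,\dots,\phi_{c_j}$ in increasing order. *The permutation $\pi_T$.* Start with the permutation $\pi$ whose one-rowed form lists the values of $C_1$ in increasing order and then the other elements of $[n]$ in increasing order. For $j=2,\dots,\lambda_1$ and, for each $j$, for $i=c_j,c_j-1,\dots,1$, replace $\pi$ by the following permutation $\pi'$. Put $i_0=i$; as long as there is a position $k>c_j$ with $\pi_{i_{x-1}}<\pi_k\le T(j,i)$, let $i_x$ be the smallest such $k$. If $i_0,\dots,i_m$ are the positions obtained, then $\pi'_{i_x}=\pi_{i_{x-1}}$ for $1\le x\le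 m$, $\pi'_{i_0}=\pi_{i_m}$, and $\pi'_a=\pi_a$ for all other $a$. The last permutation obtained is $\pi_T$. (If $\lambda=0$, then $\pi_T$ is the identity.) *Right key.* Words in the integers are considered up to Knuth equivalence, generated by $u\,yzx\,v\equiv u\,yxz\,v$ for $x<y\le z$ and $u\,xzy\,v\equiv u\,zxy\,v$ for $x\le y<z$. Each word factors uniquely into maximal strictly decreasing factors, its column factors. A word $w$ is a *frank word* for $T$ if it is Knuth equivalent to the column reading word of $T$ (columns from left to right, each read from bottom to top) and the lengths of its column factors are a rearrangement of $c_1,\dots,c_{\lambda_1}$. The right key $R(T)$ of Lascoux and Schützenberger is the key of shape $\lambda$ such that, for each $j$, frank words for $T$ whose last column factor has length $c_j$ exist, and the last column factor of each of them is the $j$-th column of $R(T)$ read from bottom to top. Then $R(T)$ is well defined, that is, exactly one key has this property, and $$Y_\lambda(\pi_T)=R(T).$$ -/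

import Mathlib

/-! Conventions. Everything is indexed from zero, as in Mathlib: `Fin n` plays the role of the set
`[n]` of values and positions, a cell `(i, j)` of a Young diagram `μ` lies in row `i` and column
`j`, `μ.colLen j` is the length of column `j` and `μ.rowLen 0` is the number of columns. A
permutation `π : Equiv.Perm (Fin n)` has one-rowed form `(π 0, π 1, …, π (n - 1))`. -/

namespace AlcoveKey

/-! ### Keys, and the key of a permutation -/

section Keys

variable {μ : YoungDiagram}

/-- A semistandard tableau is a key if every value of a column occurs in the column to its left. -/
def IsKey (K : SemistandardYoungTableau μ) : Prop :=
  ∀ i j : ℕ, (i, j + 1) ∈ μ → ∃ i' : ℕ, (i', j) ∈ μ ∧ K i' j = K i (j + 1)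

/-- The set of the first `c` entries of the one-rowed form of `φ`. -/
def firstEntries {n : ℕ} (φ : Equiv.Perm (Fin n)) (c : ℕ) : Finset (Fin n) :=
  (Finset.univ.filter fun k : Fin n => k.val < c).map φ.toEmbedding

theorem card_firstEntries {n : ℕ} (φ : Equiv.Perm (Fin n)) {c : ℕ} (hc : c ≤ n) :
    (firstEntries φ c).card = c := by
  rw [firstEntries, Finset.card_map, Fin.card_filter_val_lt, min_eq_right hc]

theorem firstEntries_mono {n : ℕ} (φ : Equiv.Perm (Fin n)) {c d : ℕ} (h : c ≤ d) :
    firstEntries φ c ⊆ firstEntries φ d := by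
  apply Finset.map_subset_map.2
  intro k hk
  simp only [Finset.mem_filter, Finset.mem_univ, true_and] at hk ⊢
  omega

/-- The `i`-th smallest element decreases when the set grows. -/
theorem orderEmbOfFin_anti {n : ℕ} {s t : Finset (Fin n)} (hst : s ⊆ t) {a b : ℕ}
    (hs : s.card = a) (ht : t.card = b) (i : ℕ) (ha : i < a) (hb : i < b) :
    t.orderEmbOfFin ht ⟨i, hb⟩ ≤ s.orderEmbOfFin hs ⟨i, ha⟩ := by
  by_contra hlt
  push Not at hlt
  have hsub : (Finset.univ.filter fun k : Fin a => k.val < i + 1).map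
      (s.orderEmbOfFin hs).toEmbedding ⊆
      (Finset.univ.filter fun k : Fin b => k.val < i).map (t.orderEmbOfFin ht).toEmbedding := by
    intro x hx
    simp only [Finset.mem_map, Finset.mem_filter, Finset.mem_univ, true_and] at hx ⊢
    obtain ⟨k, hk, rfl⟩ := hx
    have hmem : s.orderEmbOfFin hs k ∈ t := hst (Finset.orderEmbOfFin_mem s hs k)
    have hr : s.orderEmbOfFin hs k ∈ Set.range (t.orderEmbOfFin ht) := by
      rw [Finset.range_orderEmbOfFin]; exact hmem
    obtain ⟨l, hl⟩ := hr
    refine ⟨l, ?_, hl⟩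
    have h1 : s.orderEmbOfFin hs k ≤ s.orderEmbOfFin hs ⟨i, ha⟩ :=
      (s.orderEmbOfFin hs).monotone (Fin.le_def.2 (by simpa using Nat.le_of_lt_succ hk))
    have h2 : t.orderEmbOfFin ht l < t.orderEmbOfFin ht ⟨i, hb⟩ := by
      rw [hl]; exact lt_of_le_of_lt h1 hlt
    exact Fin.lt_def.1 ((t.orderEmbOfFin ht).lt_iff_lt.1 h2)
  have hc := Finset.card_le_card hsub
  rw [Finset.card_map, Finset.card_map, Fin.card_filter_val_lt, Fin.card_filter_val_lt] at hc
  omega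

theorem colLen_le_of_colLen_zero_le {n : ℕ} (hμ : μ.colLen 0 ≤ n) (j : ℕ) : μ.colLen j ≤ n :=
  (μ.colLen_anti 0 j (Nat.zero_le j)).trans hμ

/-- The `μ`-key of the permutation `φ`: the tableau of shape `μ` whose columns of length `c` contain
the first `c` entries of the one-rowed form of `φ`, in increasing order from top to bottom. -/
def permKey {n : ℕ} (hμ : μ.colLen 0 ≤ n) (φ : Equiv.Perm (Fin n)) :
    SemistandardYoungTableau μ where
  entry i j :=
    if h : (i, j) ∈ μ then
      ((firstEntries φ (μ.colLen j)).orderEmbOfFin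
        (card_firstEntries φ (colLen_le_of_colLen_zero_le hμ j))
        ⟨i, YoungDiagram.mem_iff_lt_colLen.1 h⟩).val
    else 0
  row_weak' := by
    intro i j1 j2 hj h2
    have h1 : (i, j1) ∈ μ := μ.up_left_mem le_rfl hj.le h2
    rw [dif_pos h1, dif_pos h2]
    exact Fin.le_def.1 (orderEmbOfFin_anti (firstEntries_mono φ (μ.colLen_anti j1 j2 hj.le))
      _ _ i _ _)
  col_strict' := by
    intro i1 i2 j hi h2
    have h1 : (i1, j) ∈ μ := μ.up_left_mem hi.le le_rfl h2
    rw [dif_pos h1, dif_pos h2]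
    exact Fin.lt_def.1 ((Finset.orderEmbOfFin _ _).strictMono (Fin.lt_def.2 hi))
  zeros' := by
    intro i j h
    rw [dif_neg h]

end Keys

/-! ### The final permutation produced by the inverse of the filling map -/

section AlcoveModel

variable {n : ℕ} {μ : YoungDiagram}

/-- The permutation whose one-rowed form lists the elements of `s` in increasing order, followed by
the remaining elements of `Fin n` in increasing order. -/
def listFirst (s : Finset (Fin n)) : Equiv.Perm (Fin n) :=
  (finCongr (show n = s.card + sᶜ.card by
      rw [Finset.card_add_card_compl, Fintype.card_fin])).trans
    (finSumFinEquiv.symm.trans (finSumEquivOfFinset rfl rfl))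

/-- The set of values of column `j` of `T`. -/
def colValues (n : ℕ) (T : SemistandardYoungTableau μ) (j : ℕ) : Finset (Fin n) :=
  Finset.univ.filter fun v : Fin n => ∃ i < μ.colLen j, T i j = v.val

/-- The smallest position `k ≥ c` (beyond the first `c` positions) such that `π a < π k ≤ t`,
if there is one. -/
def nextIndex (π : Equiv.Perm (Fin n)) (c t : ℕ) (a : Fin n) : Option (Fin n) :=
  (List.finRange n).find? fun k => decide (c ≤ k.val ∧ π a < π k ∧ (π k).val ≤ t)

/-- The positions `i₁, i₂, …, iₘ` chosen by the greedy algorithm from the starting position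
`i₀ = a`: each one is the smallest position `k` beyond the first `c` positions whose entry is larger
than the entry chosen before it and at most `t`. The list ends when no such position is left, in
particular when the entry `t` is reached. -/
def greedyIndices (π : Equiv.Perm (Fin n)) (c t : ℕ) (a : Fin n) : List (Fin n) :=
  match h : nextIndex π c t a with
  | none => []
  | some k => k :: greedyIndices π c t k
termination_by n - (π a).val
decreasing_by
  have hk := List.find?_some h
  simp only [decide_eq_true_eq] at hk
  have h1 : (π a).val < (π k).val := Fin.lt_def.1 hk.2.1
  have h2 : (π k).val < n := (π k).isLt
  omega

/-- The greedy algorithm executed at the cell `(i, j)` on the permutation `π`. With `i₀ = i` and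
`i₁, …, iₘ` the chosen positions, the new permutation has `π (iₓ₋₁)` in position `iₓ` for
`1 ≤ x ≤ m`, has `π iₘ` in position `i₀`, and agrees with `π` elsewhere. (`List.formPerm` sends each
member of the list to the next one and the last one to the first.) If `π i = T i j` already, then no
position is chosen and `π` does not change. -/
def greedyStep (T : SemistandardYoungTableau μ) (j i : ℕ) (π : Equiv.Perm (Fin n)) :
    Equiv.Perm (Fin n) :=
  if h : i < n then
    π * (List.formPerm
      ((⟨i, h⟩ : Fin n) :: greedyIndices π (μ.colLen j) (T i j) ⟨i, h⟩))⁻¹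
  else π

/-- The permutation obtained once the columns `0, …, j` of `T` are processed. It starts from the
permutation listing the values of column `0` and then the remaining values; afterwards each column
is processed from its lowest cell up to its top cell. -/
def alcovePermUpTo (n : ℕ) (T : SemistandardYoungTableau μ) : ℕ → Equiv.Perm (Fin n)
  | 0 => listFirst (colValues n T 0)
  | j + 1 => (List.range (μ.colLen (j + 1))).foldr (greedyStep T (j + 1)) (alcovePermUpTo n T j)

/-- The final permutation `π_T`, obtained after the last column of `T` is processed. -/
def alcovePerm (n : ℕ) (T : SemistandardYoungTableau μ) : Equiv.Perm (Fin n) :=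
  alcovePermUpTo n T (μ.rowLen 0 - 1)

end AlcoveModel

/-! ### The right key of Lascoux and Schützenberger, through frank words -/

section RightKey

variable {μ : YoungDiagram}

/-- Column `j` of `T`, read from bottom to top. -/
def columnWord (T : SemistandardYoungTableau μ) (j : ℕ) : List ℕ :=
  ((List.range (μ.colLen j)).map fun i => T i j).reverse

/-- The column reading word of `T`: the columns from left to right, each from bottom to top. -/
def tableauWord (T : SemistandardYoungTableau μ) : List ℕ :=
  ((List.range (μ.rowLen 0)).map fun j => columnWord T j).flatten

/-- The elementary Knuth relations. -/
inductive KnuthStep : List ℕ → List ℕ → Prop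
  | yzx (u v : List ℕ) {x y z : ℕ} (hxy : x < y) (hyz : y ≤ z) :
      KnuthStep (u ++ [y, z, x] ++ v) (u ++ [y, x, z] ++ v)
  | xzy (u v : List ℕ) {x y z : ℕ} (hxy : x ≤ y) (hyz : y < z) :
      KnuthStep (u ++ [x, z, y] ++ v) (u ++ [z, x, y] ++ v)

/-- Knuth (plactic) equivalence of words. -/
def KnuthEquiv : List ℕ → List ℕ → Prop :=
  Relation.EqvGen KnuthStep

/-- The factorization of a word into its maximal strictly decreasing factors, from left to right. -/
def columnFactors (w : List ℕ) : List (List ℕ) :=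
  w.splitBy fun a b => decide (b < a)

/-- `w` is a frank word in the plactic class of `T`: it is Knuth equivalent to `T`, and the lengths
of its maximal column factors are a rearrangement of the column lengths of `T`. -/
def IsFrankWordFor (T : SemistandardYoungTableau μ) (w : List ℕ) : Prop :=
  KnuthEquiv w (tableauWord T) ∧
    ((columnFactors w).map List.length).Perm ((List.range (μ.rowLen 0)).map μ.colLen)

/-- `K` is the right key of `T`: it is a key of the same shape, and for each column `j` of the shape
the last column factors, of length equal to that of column `j`, of the frank words in the plactic
class of `T` are exactly column `j` of `K`. Thus at least one such frank word exists, and all of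
them have the same last column factor. -/
def IsRightKey (T K : SemistandardYoungTableau μ) : Prop :=
  IsKey K ∧ ∀ j < μ.rowLen 0, ∀ c : List ℕ,
    (∃ w : List ℕ, IsFrankWordFor T w ∧ (columnFactors w).getLast? = some c ∧
      c.length = μ.colLen j) ↔ c = columnWord K j

/-- The right key `R(T)` of `T` (meaningful because there is exactly one `K` with
`IsRightKey T K`). -/
noncomputable def rightKey (T : SemistandardYoungTableau μ) : SemistandardYoungTableau μ :=
  Classical.epsilon fun K => IsRightKey T K

end RightKey

end AlcoveKey

/-! Two facts give the theorem: frank words of one class with last columns of equal length have the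
same last column, and for each column length the first entries of `π_T` do form such a last column.
Uniqueness rests on Greene's invariant: the number of letters of a word that can be placed on `k`
weakly increasing sequences depends only on its Knuth class, even with prescribed initial last
entries (`KnuthEquiv.canRun_iff`). A product of columns `D` allows at most the sum of the `min
D.length k` (`Run.le_sum`). The first `k` rows of a tableau attain this bound
(`canRun_tableauWord`), hence so does every frank word, since its column lengths are only
rearranged. If the last column `C` has length `k`, each of the `k` sequences then ends in a letter
of `C`, so a second copy of `C` can be appended and used completely. For an equivalent frank word
ending in `C'` of the same length, `C'` followed by `C` must then be used completely, which forces
`C' ≤ C` entrywise; by symmetry `C = C'` (`KnuthEquiv.last_column_eq`). For existence, processing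
column `j` acts on the set of the first `L` entries, for every `L ≥ μ.colLen j`, as insertion of
that column: each letter `b` replaces the largest element that is at most `b` (`greedyStep_spec`,
`foldr_greedyStep_spec`). The replaced letters again form a column of the same length, and the
exchange of the two columns is a Knuth equivalence (`Bumps.knuthEquiv`). After column `l` the first
`μ.colLen l` entries are column `l` itself; moving all later columns past it in this way yields a
frank word that ends in the first `μ.colLen l` entries of `π_T` (`exists_columns`). -/

namespace AlcoveKey

/-! ### Disjoint weakly increasing subsequences -/

section Chains

/-- `Run s w m t`: reading the word `w` from left to right, `m` letters in total are appended to
`k` weakly increasing sequences, whose last entries are `s` before and `t` after the reading. -/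
inductive Run {k : ℕ} : (Fin k → ℕ) → List ℕ → ℕ → (Fin k → ℕ) → Prop
  | nil (s) : Run s [] 0 s
  | skip {s w m t} (x) (h : Run s w m t) : Run s (x :: w) m t
  | use {s w m t} (x) (i) (hi : s i ≤ x) (h : Run (Function.update s i x) w m t) :
      Run s (x :: w) (m + 1) t

/-- From the last entries `s`, the word `w` allows `m` letters to be appended. -/
def CanRun {k : ℕ} (s : Fin k → ℕ) (w : List ℕ) (m : ℕ) : Prop :=
  ∃ t, Run s w m t

variable {k : ℕ} {s t : Fin k → ℕ} {u v w : List ℕ} {m : ℕ}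

theorem CanRun.skip (x : ℕ) (h : CanRun s w m) : CanRun s (x :: w) m :=
  h.imp fun _ => Run.skip x

theorem CanRun.use {x : ℕ} (i : Fin k) (hi : s i ≤ x) (h : CanRun (Function.update s i x) w m) :
    CanRun s (x :: w) (m + 1) :=
  h.imp fun _ => Run.use x i hi

theorem canRun_cons {x : ℕ} : CanRun s (x :: w) m ↔
    CanRun s w m ∨ ∃ i m', s i ≤ x ∧ m = m' + 1 ∧ CanRun (Function.update s i x) w m' := by
  constructor
  · rintro ⟨t, h⟩
    cases h with
    | skip _ h => exact Or.inl ⟨t, h⟩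
    | use _ i hi h => exact Or.inr ⟨i, _, hi, rfl, t, h⟩
  · rintro (h | ⟨i, m', hi, rfl, h⟩)
    · exact h.skip x
    · exact h.use i hi

theorem run_append {t' : Fin k → ℕ} {m' : ℕ} (h : Run s u m t) (h' : Run t v m' t') :
    Run s (u ++ v) (m + m') t' := by
  induction h with
  | nil s => simpa using h'
  | skip x _ ih => exact Run.skip x (ih h')
  | use x i hi _ ih => rw [Nat.add_right_comm]; exact Run.use x i hi (ih h')

theorem exists_of_run_append (h : Run s (u ++ v) m t) :
    ∃ m₁ m₂ r, Run s u m₁ r ∧ Run r v m₂ t ∧ m = m₁ + m₂ := by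
  induction u generalizing s m with
  | nil => exact ⟨0, m, s, Run.nil s, h, by simp⟩
  | cons x u ih =>
    cases h with
    | skip _ h =>
      obtain ⟨m₁, m₂, r, h₁, h₂, e⟩ := ih h
      exact ⟨m₁, m₂, r, h₁.skip x, h₂, e⟩
    | use _ i hi h =>
      obtain ⟨m₁, m₂, r, h₁, h₂, e⟩ := ih h
      exact ⟨m₁ + 1, m₂, r, h₁.use x i hi, h₂, by omega⟩

/-- Smaller last entries, in any order, allow as many letters to be appended. -/
theorem CanRun.mono {s' : Fin k → ℕ} (σ : Equiv.Perm (Fin k)) (hs : ∀ i, s' (σ i) ≤ s i)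
    (h : CanRun s w m) : CanRun s' w m := by
  obtain ⟨t, h⟩ := h
  induction h generalizing s' with
  | nil s => exact ⟨s', Run.nil s'⟩
  | skip x _ ih => exact (ih hs).skip x
  | @use s w m t x i hi _ ih =>
    refine CanRun.use (σ i) ((hs i).trans hi) (ih fun l => ?_)
    by_cases hl : l = i
    · subst hl; simp
    · simp [Function.update_of_ne hl, Function.update_of_ne (σ.injective.ne hl), hs l]

theorem CanRun.append_left {w' : List ℕ} (h : ∀ s : Fin k → ℕ, ∀ m, CanRun s w m → CanRun s w' m)
    (hu : CanRun s (u ++ w) m) : CanRun s (u ++ w') m := by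
  obtain ⟨t, hu⟩ := hu
  obtain ⟨m₁, m₂, r, h₁, h₂, rfl⟩ := exists_of_run_append hu
  obtain ⟨t', h'⟩ := h r m₂ ⟨t, h₂⟩
  exact ⟨t', run_append h₁ h'⟩

/-- Two adjacent letters of which the first is the larger one may be interchanged. -/
theorem CanRun.swap {x z : ℕ} (hxz : x < z) (h : CanRun s (z :: x :: v) m) :
    CanRun s (x :: z :: v) m := by
  rw [canRun_cons] at h
  rcases h with h | ⟨i, m', hi, rfl, h⟩
  · rw [canRun_cons] at h; rcases h with h | ⟨j, m', hj, rfl, h⟩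
    · exact (h.skip z).skip x
    · exact (h.skip z).use j hj
  · rw [canRun_cons] at h; rcases h with h | ⟨j, m'', hj, rfl, h⟩
    · exact (h.use i hi).skip x
    -- The smaller letter `x` cannot follow `z` on one sequence, so two different sequences are
    -- involved and the two moves commute.
    · have hij : i ≠ j := by rintro rfl; simp at hj; omega
      rw [Function.update_of_ne hij.symm] at hj
      refine CanRun.use j hj (CanRun.use i (by rwa [Function.update_of_ne hij]) ?_)
      rwa [Function.update_comm hij.symm]

/-- The only obstruction to interchanging `x` and `z` is that both go to one sequence; the letter
`y` in front then allows a redistribution with equally many letters and no worse last entries. -/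
theorem CanRun.yxz_to_yzx {x y z : ℕ} (hxy : x < y) (hyz : y ≤ z)
    (h : CanRun s (y :: x :: z :: v) m) : CanRun s (y :: z :: x :: v) m := by
  -- the pair `x, z` may be interchanged unless both are appended to one sequence
  have key : ∀ (s : Fin k → ℕ) (m : ℕ), CanRun s (x :: z :: v) m →
      CanRun s (z :: x :: v) m ∨ ∃ i m', s i ≤ x ∧ m = m' + 2 ∧
        CanRun (Function.update s i z) v m' := by
    intro s m h
    rw [canRun_cons] at h; rcases h with h | ⟨i, m', hi, rfl, h⟩
    · rw [canRun_cons] at h; rcases h with h | ⟨j, m', hj, rfl, h⟩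
      · exact Or.inl ((h.skip x).skip z)
      · exact Or.inl ((h.skip x).use j hj)
    · rw [canRun_cons] at h; rcases h with h | ⟨j, m'', hj, rfl, h⟩
      · exact Or.inl ((h.use i hi).skip z)
      · by_cases hij : i = j
        · subst hij
          rw [Function.update_idem] at h
          exact Or.inr ⟨i, m'', hi, rfl, h⟩
        · left
          rw [Function.update_of_ne (Ne.symm hij)] at hj
          refine CanRun.use j hj (CanRun.use i (by rwa [Function.update_of_ne hij]) ?_)
          rwa [Function.update_comm (Ne.symm hij)]
  rw [canRun_cons] at h; rcases h with h | ⟨j, m', hj, rfl, h⟩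
  · replace h := key s m h; rcases h with h | ⟨i, m', hi, rfl, h⟩
    · exact h.skip y
    -- With `y` unused, sequence `i` takes `y, z` in place of `x, z`.
    · refine CanRun.use i (by omega) (CanRun.use i (by simpa using hyz) (CanRun.skip x ?_))
      rwa [Function.update_idem]
  · replace h := key _ m' h; rcases h with h | ⟨i, m', hi, rfl, h⟩
    · exact h.use j hj
    · have hij : i ≠ j := by rintro rfl; simp at hi; omega
      rw [Function.update_of_ne hij] at hi
      -- Sequence `j` takes `y, z` and sequence `i` takes `x`. The last entries `y, z` become `z,
      -- x`, which is no worse after exchanging `i` and `j`.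
      refine CanRun.use j hj (CanRun.use j (by simpa using hyz) (CanRun.use i
        (by simpa [hij] using hi) (h.mono (Equiv.swap i j) fun l => ?_)))
      by_cases hli : l = i
      · subst hli; simp [hij.symm]
      · by_cases hlj : l = j
        · subst hlj; simp [hli]; omega
        · simp [Equiv.swap_apply_of_ne_of_ne hli hlj, hli, hlj]

/-- If `x` and `z` share a sequence, then `y` can take the place of `z` behind `x`. -/
theorem CanRun.xzy_to_zxy {x y z : ℕ} (hxy : x ≤ y) (hyz : y < z)
    (h : CanRun s (x :: z :: y :: v) m) : CanRun s (z :: x :: y :: v) m := by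
  rw [canRun_cons] at h
  rcases h with h | ⟨i, m', hi, rfl, h⟩
  · rw [canRun_cons] at h; rcases h with h | ⟨j, m', hj, rfl, h⟩
    · exact (h.skip x).skip z
    · exact (h.skip x).use j hj
  · rw [canRun_cons] at h; rcases h with h | ⟨j, m'', hj, rfl, h⟩
    · exact (h.use i hi).skip z
    · by_cases hij : i = j
      · subst hij
        rw [Function.update_idem] at h
        rw [canRun_cons] at h; rcases h with h | ⟨l, m₃, hl, rfl, h⟩
        · refine CanRun.skip z (CanRun.use i hi (CanRun.use i (by simpa using hxy) ?_))
          refine h.mono (Equiv.refl _) fun l => ?_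
          by_cases hl : l = i
          · subst hl; simp; omega
          · simp [hl]
        · have hil : l ≠ i := by rintro rfl; simp at hl; omega
          rw [Function.update_of_ne hil] at hl
          -- The continuations `z` of sequence `i` and `y` of sequence `l` trade places, so the last
          -- entries are merely permuted.
          refine CanRun.use l (by omega) (CanRun.use i (by simpa [hil.symm] using hi)
            (CanRun.use i (by simpa using hxy) (h.mono (Equiv.swap i l) fun p => ?_)))
          by_cases hpi : p = i
          · subst hpi; simp [hil, hil.symm]
          · by_cases hpl : p = l
            · subst hpl; simp
            · simp [Equiv.swap_apply_of_ne_of_ne hpi hpl, hpi, hpl]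
      · rw [Function.update_of_ne (Ne.symm hij)] at hj
        refine CanRun.use j hj (CanRun.use i (by rwa [Function.update_of_ne hij]) ?_)
        rwa [Function.update_comm (Ne.symm hij)]

theorem KnuthStep.canRun_iff {w' : List ℕ} (h : KnuthStep w w') :
    CanRun s w m ↔ CanRun s w' m := by
  cases h with
  | yzx u v hxy hyz =>
    simp only [List.append_assoc, List.cons_append, List.nil_append]
    refine ⟨CanRun.append_left fun s m h => ?_,
      CanRun.append_left fun s m h => h.yxz_to_yzx hxy hyz⟩
    exact CanRun.append_left (u := [_]) (fun s m h => h.swap (hxy.trans_le hyz)) h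
  | xzy u v hxy hyz =>
    simp only [List.append_assoc, List.cons_append, List.nil_append]
    exact ⟨CanRun.append_left fun s m h => h.xzy_to_zxy hxy hyz,
      CanRun.append_left fun s m h => h.swap (hxy.trans_lt hyz)⟩

theorem KnuthEquiv.canRun_iff {w' : List ℕ} (h : KnuthEquiv w w') :
    CanRun s w m ↔ CanRun s w' m := by
  induction h with
  | rel _ _ h => exact h.canRun_iff
  | refl => exact Iff.rfl
  | symm _ _ _ ih => exact ih.symm
  | trans _ _ _ _ _ ih₁ ih₂ => exact ih₁.trans ih₂

/-- A decreasing subword meets each increasing sequence at most once. -/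
theorem Run.add_length_le_card {D : List ℕ} (h : Run s w m t) (hD : D.Sublist w)
    (hdec : D.Pairwise (· > ·)) :
    m + D.length ≤ w.length + (Finset.univ.filter fun i => ∃ d ∈ D, s i ≤ d).card := by
  induction h generalizing D with
  | nil s => simp [List.sublist_nil.1 hD]
  | @skip s w m t x _ ih =>
    rcases List.sublist_cons_iff.1 hD with hD | ⟨D', rfl, hD'⟩
    · have := ih hD hdec
      simp only [List.length_cons]; omega
    · have h1 := ih hD' (List.pairwise_cons.1 hdec).2
      have h2 : (Finset.univ.filter fun i => ∃ d ∈ D', s i ≤ d).card ≤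
          (Finset.univ.filter fun i => ∃ d ∈ x :: D', s i ≤ d).card :=
        Finset.card_le_card fun i => by
          simp only [Finset.mem_filter, Finset.mem_univ, true_and]
          rintro ⟨d, hd, hi⟩
          exact ⟨d, List.mem_cons_of_mem _ hd, hi⟩
      simp only [List.length_cons]; omega
  | @use s w m t x i hi _ ih =>
    rcases List.sublist_cons_iff.1 hD with hD | ⟨D', rfl, hD'⟩
    · have h1 := ih hD hdec
      have h2 : (Finset.univ.filter fun l => ∃ d ∈ D, Function.update s i x l ≤ d).card ≤
          (Finset.univ.filter fun l => ∃ d ∈ D, s l ≤ d).card :=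
        Finset.card_le_card fun l => by
          simp only [Finset.mem_filter, Finset.mem_univ, true_and]
          rintro ⟨d, hd, hl⟩
          refine ⟨d, hd, le_trans ?_ hl⟩
          by_cases hli : l = i
          · subst hli; simpa using hi
          · simp [hli]
      simp only [List.length_cons]; omega
    · obtain ⟨hx, hdec'⟩ := List.pairwise_cons.1 hdec
      have h1 := ih hD' hdec'
      -- Once `i` ends in `x`, it can take no later letter of the decreasing word, so `i` leaves the
      -- counted set.
      have h2 : (Finset.univ.filter fun l => ∃ d ∈ D', Function.update s i x l ≤ d).card <
          (Finset.univ.filter fun l => ∃ d ∈ x :: D', s l ≤ d).card := by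
        refine Finset.card_lt_card (Finset.ssubset_iff_of_subset ?_ |>.2 ⟨i, ?_, ?_⟩)
        · intro l
          simp only [Finset.mem_filter, Finset.mem_univ, true_and]
          rintro ⟨d, hd, hl⟩
          by_cases hli : l = i
          · subst hli; exact ⟨x, List.mem_cons_self, hi⟩
          · exact ⟨d, List.mem_cons_of_mem _ hd, by simpa [hli] using hl⟩
        · simp only [Finset.mem_filter, Finset.mem_univ, true_and]
          exact ⟨x, List.mem_cons_self, hi⟩
        · simp only [Finset.mem_filter, Finset.mem_univ, true_and, Function.update_self]
          rintro ⟨d, hd, hl⟩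
          exact absurd (hx d hd) (by omega)
      simp only [List.length_cons]; omega

theorem Run.add_length_le {D : List ℕ} (h : Run s w m t) (hD : D.Sublist w)
    (hdec : D.Pairwise (· > ·)) : m + D.length ≤ w.length + k :=
  (h.add_length_le_card hD hdec).trans (Nat.add_le_add_left
    ((Finset.card_le_univ _).trans (Fintype.card_fin k).le) _)

theorem Run.le_length (h : Run s w m t) : m ≤ w.length := by
  induction h with
  | nil => simp
  | skip x _ ih => simp only [List.length_cons]; omega
  | use x j hj _ ih => simp only [List.length_cons]; omega

theorem Run.le_sum {Ds : List (List ℕ)} (hDs : ∀ D ∈ Ds, D.Pairwise (· > ·))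
    (h : Run s Ds.flatten m t) : m ≤ (Ds.map fun D => min D.length k).sum := by
  induction Ds generalizing s m with
  | nil => cases h; simp
  | cons D Ds ih =>
    rw [List.flatten_cons] at h
    obtain ⟨m₁, m₂, r, h₁, h₂, rfl⟩ := exists_of_run_append h
    have h3 := ih (fun D hD => hDs D (List.mem_cons_of_mem _ hD)) h₂
    have h4 := h₁.le_length
    have h5 := h₁.add_length_le (List.Sublist.refl D) (hDs D List.mem_cons_self)
    simp only [List.map_cons, List.sum_cons]
    omega

theorem Run.apply_eq_of_forall_lt {i : Fin k} (h : Run s w m t) (hi : ∀ x ∈ w, x < s i) :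
    t i = s i := by
  induction h with
  | nil => rfl
  | skip x _ ih => exact ih fun y hy => hi y (List.mem_cons_of_mem _ hy)
  | @use s w m t x j hj _ ih =>
    have hij : i ≠ j := by
      rintro rfl
      exact absurd (hi x List.mem_cons_self) (by omega)
    have hu : Function.update s j x i = s i := Function.update_of_ne hij _ _
    rw [hu] at ih
    exact ih fun y hy => hi y (List.mem_cons_of_mem _ hy)

/-- If all letters of a decreasing word are used, each of them ends a sequence of its own. -/
theorem Run.exists_injOn (h : Run s w m t) (hw : w.Pairwise (· > ·)) (hm : m = w.length) :
    ∃ g : ℕ → Option (Fin k), ∀ x ∈ w, ∃ i, g x = some i ∧ t i = x := by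
  induction h with
  | nil => exact ⟨fun _ => none, by simp⟩
  | @skip s w m t x h ih =>
    have := h.le_length
    simp only [List.length_cons] at hm; omega
  | @use s w m t x j hj h ih =>
    obtain ⟨hx, hw'⟩ := List.pairwise_cons.1 hw
    obtain ⟨g, hg⟩ := ih hw' (by simpa using hm)
    have hj' : t j = x := by
      rw [h.apply_eq_of_forall_lt (i := j) (by simpa using hx)]; simp
    refine ⟨Function.update g x (some j), fun y hy => ?_⟩
    by_cases hyx : y = x
    · subst hyx; exact ⟨j, by simp, hj'⟩
    · rw [Function.update_of_ne hyx]
      exact hg y ((List.mem_cons.1 hy).resolve_left hyx)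

theorem canRun_of_forall_mem_range (hw : w.Nodup) (h : ∀ x ∈ w, ∃ i, s i = x) :
    CanRun s w w.length := by
  induction w with
  | nil => exact ⟨s, Run.nil s⟩
  | cons x w ih =>
    obtain ⟨i, hi⟩ := h x List.mem_cons_self
    refine CanRun.use i hi.le ?_
    rw [← hi, Function.update_eq_self]
    exact ih (List.nodup_cons.1 hw).2 fun y hy => h y (List.mem_cons_of_mem _ hy)

/-- If a column of length `k` at the end of a word is used completely, it can be repeated. -/
theorem CanRun.repeat_last {Ds : List (List ℕ)} {C : List ℕ}
    (hDs : ∀ D ∈ Ds, D.Pairwise (· > ·)) (hc : C.Pairwise (· > ·)) (hk : C.length = k)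
    (h : CanRun s (Ds.flatten ++ C) ((Ds.map fun D => min D.length k).sum + k)) :
    CanRun s (Ds.flatten ++ C ++ C) ((Ds.map fun D => min D.length k).sum + k + k) := by
  obtain ⟨t, h⟩ := h
  obtain ⟨m₁, m₂, r, h₁, h₂, e⟩ := exists_of_run_append h
  -- The earlier columns contribute at most their bound, so all `k` letters of `C` are used.
  have h3 := h₁.le_sum hDs
  have h4 := h₂.le_length
  obtain ⟨g, hg⟩ := h₂.exists_injOn hc (by omega)
  obtain ⟨t', h'⟩ := canRun_of_forall_mem_range (s := t) (w := C) (hc.imp fun h => h.ne')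
    fun x hx => (hg x hx).imp fun i hi => hi.2
  rw [hk] at h'
  exact ⟨t', run_append h h'⟩

/-- Two successive columns of length `k` at the end of a word are used completely only if the first
is entrywise at most the second. -/
theorem CanRun.le_of_columns {Ds : List (List ℕ)} {C C' : List ℕ}
    (hDs : ∀ D ∈ Ds, D.Pairwise (· > ·)) (hc : C.Pairwise (· > ·)) (hc' : C'.Pairwise (· > ·))
    (hk : C.length = k) (hk' : C'.length = k)
    (h : CanRun s (Ds.flatten ++ C ++ C') ((Ds.map fun D => min D.length k).sum + k + k))
    (i : ℕ) (hi : i < C.length) (hi' : i < C'.length) : C[i] ≤ C'[i] := by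
  by_contra! hlt
  obtain ⟨t, h⟩ := h
  rw [List.append_assoc] at h
  obtain ⟨m₁, m₂, r, h₁, h₂, e⟩ := exists_of_run_append h
  have h3 := h₁.le_sum hDs
  -- If `C[i] > C'[i]`, these pieces form a decreasing subword of length `k + 1`. It meets `k`
  -- sequences in at most `k` letters, so some letter of the two columns stays unused.
  have h4 := h₂.add_length_le (D := C.take (i + 1) ++ C'.drop i)
    ((List.take_sublist _ _).append (List.drop_sublist _ _)) (by
      refine List.pairwise_append.2 ⟨hc.sublist (List.take_sublist _ _),
        hc'.sublist (List.drop_sublist _ _), fun x hx y hy => ?_⟩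
      obtain ⟨p, hp, rfl⟩ := List.mem_take_iff_getElem.1 hx
      obtain ⟨q, hq, rfl⟩ := List.mem_drop_iff_getElem.1 hy
      have hp' : C[i] ≤ C[p] := by
        rcases (show p ≤ i by omega).eq_or_lt with rfl | hpi
        · exact le_rfl
        · exact (List.pairwise_iff_getElem.1 hc p i _ _ hpi).le
      have hq' : C'[i + q] ≤ C'[i] := by
        rcases (Nat.le_add_right i q).eq_or_lt with he | hiq
        · simp [← he]
        · exact (List.pairwise_iff_getElem.1 hc' i (i + q) _ _ hiq).le
      exact lt_of_le_of_lt hq' (lt_of_lt_of_le hlt hp'))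
  simp only [List.length_append, List.length_take, List.length_drop] at h4
  omega

end Chains

/-! ### Knuth equivalence as a congruence, and comparison of last columns -/

theorem KnuthEquiv.append_right {w w' : List ℕ} (h : KnuthEquiv w w') (v : List ℕ) :
    KnuthEquiv (w ++ v) (w' ++ v) := by
  induction h with
  | rel _ _ h =>
    refine Relation.EqvGen.rel _ _ ?_
    cases h with
    | yzx u v' hxy hyz => simpa using KnuthStep.yzx u (v' ++ v) hxy hyz
    | xzy u v' hxy hyz => simpa using KnuthStep.xzy u (v' ++ v) hxy hyz
  | refl => exact Relation.EqvGen.refl _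
  | symm _ _ _ ih => exact ih.symm
  | trans _ _ _ _ _ ih₁ ih₂ => exact ih₁.trans _ _ _ ih₂

theorem KnuthEquiv.append_left {w w' : List ℕ} (h : KnuthEquiv w w') (v : List ℕ) :
    KnuthEquiv (v ++ w) (v ++ w') := by
  induction h with
  | rel _ _ h =>
    refine Relation.EqvGen.rel _ _ ?_
    cases h with
    | yzx u v' hxy hyz => simpa using KnuthStep.yzx (v ++ u) v' hxy hyz
    | xzy u v' hxy hyz => simpa using KnuthStep.xzy (v ++ u) v' hxy hyz
  | refl => exact Relation.EqvGen.refl _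
  | symm _ _ _ ih => exact ih.symm
  | trans _ _ _ _ _ ih₁ ih₂ => exact ih₁.trans _ _ _ ih₂

theorem KnuthEquiv.refl (w : List ℕ) : KnuthEquiv w w :=
  Relation.EqvGen.refl w

theorem KnuthEquiv.symm {w w' : List ℕ} (h : KnuthEquiv w w') : KnuthEquiv w' w :=
  Relation.EqvGen.symm _ _ h

theorem KnuthEquiv.trans {u v w : List ℕ} (h : KnuthEquiv u v) (h' : KnuthEquiv v w) :
    KnuthEquiv u w :=
  Relation.EqvGen.trans _ _ _ h h'

/-- The last column of a word that is a product of columns is determined by its length and the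
Knuth class of the word, provided that for each `k` the word contains `k` disjoint weakly increasing
subsequences of the largest total length compatible with the lengths of the columns. -/
theorem KnuthEquiv.last_column_eq {Ds Ds' : List (List ℕ)} {C C' : List ℕ}
    (hDs : ∀ D ∈ Ds, D.Pairwise (· > ·)) (hDs' : ∀ D ∈ Ds', D.Pairwise (· > ·))
    (hc : C.Pairwise (· > ·)) (hc' : C'.Pairwise (· > ·)) (hcc : C.length = C'.length)
    (hperm : (Ds.map List.length).Perm (Ds'.map List.length))
    (hequiv : KnuthEquiv (Ds.flatten ++ C) (Ds'.flatten ++ C'))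
    (hrun : CanRun (fun _ : Fin C.length => 0) (Ds.flatten ++ C)
      ((Ds.map fun D => min D.length C.length).sum + C.length)) :
    C = C' := by
  have hsum : (Ds.map fun D => min D.length C.length).sum =
      (Ds'.map fun D => min D.length C.length).sum := by
    have := (hperm.map fun l => min l C.length).sum_eq
    simpa [List.map_map, Function.comp_def] using this
  have hrun' := hequiv.canRun_iff.1 hrun
  rw [hsum] at hrun'
  -- Both words are prolonged by `C`, then both by `C'`; each time the maximum attained by the
  -- repeated column is transferred to the other word.
  have h1 := (hequiv.append_right C).canRun_iff.1 (hrun.repeat_last hDs hc rfl)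
  have h2 := (hequiv.append_right C').canRun_iff.2 (hrun'.repeat_last hDs' hc' hcc.symm)
  rw [hsum] at h1
  rw [← hsum] at h2
  refine List.ext_getElem hcc fun i hi hi' => le_antisymm ?_ ?_
  · exact h2.le_of_columns hDs hc hc' rfl hcc.symm i hi hi'
  · exact h1.le_of_columns hDs' hc' hc hcc.symm rfl i hi' hi

/-! ### Inserting letters into a column -/

section Bumps

variable {A : Finset ℕ}

/-- The column word of a finite set: its elements in decreasing order. -/
def decWord (A : Finset ℕ) : List ℕ :=
  A.sort (· ≥ ·)

theorem mem_decWord {x : ℕ} : x ∈ decWord A ↔ x ∈ A :=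
  Finset.mem_sort _

theorem pairwise_decWord (A : Finset ℕ) : (decWord A).Pairwise (· > ·) :=
  (Finset.sortedGT_sort A).pairwise

theorem length_decWord (A : Finset ℕ) : (decWord A).length = A.card :=
  Finset.length_sort _

theorem eq_decWord {l : List ℕ} (hl : l.Pairwise (· > ·)) (hA : ∀ x, x ∈ l ↔ x ∈ A) :
    l = decWord A := by
  refine List.Perm.eq_of_pairwise (le := (· > ·)) (fun a b _ _ h h' => by omega) hl
    (pairwise_decWord A) ((List.perm_ext_iff_of_nodup (hl.imp fun h => h.ne')
      ((pairwise_decWord A).imp fun h => h.ne')).2 fun x => (hA x).trans mem_decWord.symm)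

/-- `b` passes the letters of `l` one at a time; the left neighbour of the letter passed is the
middle value `y` of the Knuth relation. -/
theorem knuthEquiv_move_left {a b : ℕ} {l : List ℕ} (hl : (a :: l).Pairwise (· > ·))
    (hab : a ≤ b) : KnuthEquiv (a :: l ++ [b]) (a :: b :: l) := by
  induction l generalizing a with
  | nil => exact KnuthEquiv.refl _
  | cons x l ih =>
    obtain ⟨h1, h2⟩ := List.pairwise_cons.1 hl
    have hxa : x < a := h1 x List.mem_cons_self
    refine ((ih h2 (hxa.le.trans hab)).append_left [a]).trans ?_
    exact (Relation.EqvGen.rel _ _ (KnuthStep.yzx [] l hxa hab)).symm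

/-- `a` passes the letters of `l` from right to left; the right neighbour of the letter passed is
the middle value `y` of the Knuth relation. -/
theorem knuthEquiv_move_right {a b : ℕ} {l : List ℕ} (hl : (l ++ [b]).Pairwise (· > ·))
    (hab : a ≤ b) : KnuthEquiv (l ++ [a, b]) (a :: l ++ [b]) := by
  induction l with
  | nil => exact KnuthEquiv.refl _
  | cons z l ih =>
    obtain ⟨h1, h2⟩ := List.pairwise_cons.1 hl
    refine ((ih h2).append_left [z]).trans ?_
    cases l with
    | nil =>
      exact (Relation.EqvGen.rel _ _ (KnuthStep.xzy [] [] hab (h1 b (by simp)))).symm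
    | cons y l =>
      have hby : b < y := (List.pairwise_cons.1 h2).1 b (by simp)
      exact (Relation.EqvGen.rel _ _ (KnuthStep.xzy [] (l ++ [b]) (hab.trans hby.le)
        (h1 y (by simp)))).symm

/-- The letter `b` replaces the largest element of a column that is at most `b`. -/
theorem knuthEquiv_insert {a b : ℕ} (ha : a ∈ A) (hab : a ≤ b) (hmax : ∀ x ∈ A, x ≤ b → x ≤ a) :
    KnuthEquiv (decWord A ++ [b]) (a :: decWord (insert b (A.erase a))) := by
  have hbig : ∀ x ∈ decWord (A.filter (a < ·)), b < x := by
    intro x hx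
    rw [mem_decWord, Finset.mem_filter] at hx
    by_contra! h
    exact absurd (hmax x hx.1 h) (by omega)
  have hsmall : ∀ x ∈ decWord (A.filter (· < a)), x < a := by
    intro x hx
    rw [mem_decWord, Finset.mem_filter] at hx
    exact hx.2
  have hb : ((decWord (A.filter (a < ·))) ++ [b]).Pairwise (· > ·) := by
    refine List.pairwise_append.2 ⟨pairwise_decWord _, List.pairwise_singleton _ _, ?_⟩
    intro x hx y hy
    rw [List.mem_singleton.1 hy]
    exact hbig x hx
  have ha' : (a :: decWord (A.filter (· < a))).Pairwise (· > ·) :=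
    List.pairwise_cons.2 ⟨hsmall, pairwise_decWord _⟩
  have e1 : decWord A = decWord (A.filter (a < ·)) ++ a :: decWord (A.filter (· < a)) := by
    refine (eq_decWord (List.pairwise_append.2 ⟨pairwise_decWord _, ha', ?_⟩) ?_).symm
    · intro x hx y hy
      have := hbig x hx
      rcases List.mem_cons.1 hy with rfl | hy
      · show _ < _; omega
      · have := hsmall y hy; show _ < _; omega
    · intro x
      simp only [List.mem_append, List.mem_cons, mem_decWord, Finset.mem_filter]
      rcases lt_trichotomy x a with h | rfl | h
      · simp [h, h.ne, h.le]
      · simp [ha]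
      · simp [h, h.ne', h.le]
  have e2 : decWord (insert b (A.erase a)) =
      decWord (A.filter (a < ·)) ++ b :: decWord (A.filter (· < a)) := by
    refine (eq_decWord (List.pairwise_append.2 ⟨pairwise_decWord _,
      List.pairwise_cons.2 ⟨fun x hx => (hsmall x hx).trans_le hab, pairwise_decWord _⟩, ?_⟩)
      ?_).symm
    · intro x hx y hy
      have := hbig x hx
      rcases List.mem_cons.1 hy with rfl | hy
      · exact this
      · have := hsmall y hy; show _ < _; omega
    · intro x
      simp only [List.mem_append, List.mem_cons, mem_decWord, Finset.mem_filter, Finset.mem_insert,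
        Finset.mem_erase]
      rcases lt_trichotomy x a with h | rfl | h
      · simp [h, h.ne, h.le]
      · simp
      · simp only [h, h.ne', h.not_gt, true_and, and_true, and_false, or_false, ne_eq,
          not_false_eq_true]
        exact or_comm
  rw [e1, e2]
  -- With `U` and `V` the parts of the column above and below `a`, the word `U a V b` becomes `U a b
  -- V` and then `a U b V`.
  have h1 := (knuthEquiv_move_left ha' hab).append_left (decWord (A.filter (a < ·)))
  have h2 := (knuthEquiv_move_right hb hab).append_right (decWord (A.filter (· < a)))
  simp only [List.append_assoc, List.cons_append, List.nil_append] at h1 h2 ⊢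
  exact h1.trans h2

/-- Inserting the letters of `bs` one after the other into the column `A`, each of them replacing
the largest element that is at most equal to it, leads to `A'`; the replaced letters are `ms`. -/
inductive Bumps : Finset ℕ → List ℕ → List ℕ → Finset ℕ → Prop
  | nil (A : Finset ℕ) : Bumps A [] [] A
  | cons {A A' : Finset ℕ} {bs ms : List ℕ} {a b : ℕ} (ha : a ∈ A) (hab : a ≤ b)
      (hmax : ∀ x ∈ A, x ≤ b → x ≤ a) (h : Bumps (insert b (A.erase a)) bs ms A') : Bumps A (b :: bs) (a :: ms) A'

variable {A' : Finset ℕ} {bs ms : List ℕ}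

theorem Bumps.knuthEquiv (h : Bumps A bs ms A') :
    KnuthEquiv (decWord A ++ bs) (ms ++ decWord A') := by
  induction h with
  | nil => simpa using KnuthEquiv.refl _
  | @cons A A' bs ms a b ha hab hmax _ ih =>
    have := (knuthEquiv_insert ha hab hmax).append_right bs
    rw [List.append_assoc] at this
    exact this.trans (ih.append_left [a])

theorem Bumps.length_eq (h : Bumps A bs ms A') : ms.length = bs.length := by
  induction h with
  | nil => rfl
  | cons _ _ _ _ ih => simp [ih]

theorem Bumps.mem_of_forall_lt {x : ℕ} (h : Bumps A bs ms A') (hx : x ∈ A)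
    (hbs : ∀ b ∈ bs, b < x) : x ∈ A' := by
  induction h with
  | nil => exact hx
  | @cons A A' bs ms a b ha hab hmax _ ih =>
    have hb := hbs b List.mem_cons_self
    exact ih (Finset.mem_insert_of_mem (Finset.mem_erase.2 ⟨by omega, hx⟩))
      fun y hy => hbs y (List.mem_cons_of_mem _ hy)

theorem Bumps.mem_right {b : ℕ} (h : Bumps A bs ms A') (hbs : bs.Pairwise (· > ·)) (hb : b ∈ bs) :
    b ∈ A' := by
  induction h with
  | nil => simp at hb
  | @cons A A' bs ms a b' ha hab hmax h ih =>
    obtain ⟨h1, h2⟩ := List.pairwise_cons.1 hbs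
    rcases List.mem_cons.1 hb with rfl | hb
    · exact h.mem_of_forall_lt (Finset.mem_insert_self _ _) h1
    · exact ih h2 hb

theorem Bumps.exists_le {b : ℕ} (h : Bumps A bs ms A') (hb : b ∈ bs) : ∃ a ∈ ms, a ≤ b := by
  induction h with
  | nil => simp at hb
  | @cons A A' bs ms a b' ha hab hmax h ih =>
    rcases List.mem_cons.1 hb with rfl | hb
    · exact ⟨a, List.mem_cons_self, hab⟩
    · obtain ⟨a', ha', h'⟩ := ih hb
      exact ⟨a', List.mem_cons_of_mem _ ha', h'⟩

/-- The first inserted letter is the largest, so the letter it replaces is already at least `e`.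
Together with `Bumps.exists_le` this keeps the replaced column from merging with its neighbours in a
frank word. -/
theorem Bumps.exists_ge {e b : ℕ} (h : Bumps A bs ms A') (hbs : bs.Pairwise (· > ·)) (he : e ∈ A)
    (hb : b ∈ bs) (heb : e ≤ b) : ∃ a ∈ ms, e ≤ a := by
  cases h with
  | nil => simp at hb
  | @cons _ _ bs ms a b' ha hab hmax h =>
    refine ⟨a, List.mem_cons_self, hmax e he (heb.trans ?_)⟩
    rcases List.mem_cons.1 hb with rfl | hb
    · exact le_rfl
    · exact ((List.pairwise_cons.1 hbs).1 b hb).le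

/-- The gap in the column between `a` (inclusive) and `b` (exclusive) guarantees that a letter below
`b` replaces a letter below `a`. For the later, still smaller letters the bound `b` is lowered to
the letter just inserted. -/
theorem Bumps.lt_of_forall_lt {a b : ℕ} (h : Bumps A bs ms A') (hbs : bs.Pairwise (· > ·))
    (hb : ∀ x ∈ bs, x < b) (hA : ∀ x ∈ A, x < b → x < a) : ∀ x ∈ ms, x < a := by
  induction h generalizing b with
  | nil => simp
  | @cons A A' bs ms a' b' ha hab hmax h ih =>
    have hb' := hb b' List.mem_cons_self
    obtain ⟨h1, h2⟩ := List.pairwise_cons.1 hbs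
    intro x hx
    rcases List.mem_cons.1 hx with rfl | hx
    · exact hA x ha (hab.trans_lt hb')
    · refine ih h2 h1 (fun y hy hyb => ?_) x hx
      rcases Finset.mem_insert.1 hy with rfl | hy
      · exact absurd hyb (lt_irrefl _)
      · exact hA y (Finset.mem_of_mem_erase hy) (hyb.trans hb')

theorem Bumps.pairwise (h : Bumps A bs ms A') (hbs : bs.Pairwise (· > ·)) :
    ms.Pairwise (· > ·) := by
  induction h with
  | nil => exact List.Pairwise.nil
  | @cons A A' bs ms a b ha hab hmax h ih =>
    obtain ⟨h1, h2⟩ := List.pairwise_cons.1 hbs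
    refine List.pairwise_cons.2 ⟨h.lt_of_forall_lt h2 h1 fun x hx hxb => ?_, ih h2⟩
    rcases Finset.mem_insert.1 hx with rfl | hx
    · exact absurd hxb (lt_irrefl _)
    · obtain ⟨hne, hx⟩ := Finset.mem_erase.1 hx
      exact lt_of_le_of_ne (hmax x hx hxb.le) hne

end Bumps

/-! ### The greedy algorithm -/

section Greedy

variable {n : ℕ} {π : Equiv.Perm (Fin n)} {c t : ℕ}

theorem mem_firstEntries {L : ℕ} {v : Fin n} :
    v ∈ firstEntries π L ↔ ∃ p : Fin n, p.val < L ∧ π p = v := by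
  simp only [firstEntries, Finset.mem_map, Finset.mem_filter, Finset.mem_univ, true_and,
    Equiv.coe_toEmbedding]

/-- The permutation obtained by moving entries along the greedy positions, starting from `a`. -/
def greedyPerm (π : Equiv.Perm (Fin n)) (c t : ℕ) (a : Fin n) : Equiv.Perm (Fin n) :=
  π * (List.formPerm (a :: greedyIndices π c t a))⁻¹

theorem greedyPerm_of_none {a : Fin n} (h : nextIndex π c t a = none) :
    greedyPerm π c t a = π := by
  rw [greedyPerm, greedyIndices]
  split
  · simp
  · simp_all

/-- This recursion reduces a start at `a` to a start at the next greedy position `k`, up to an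
exchange of two positions. -/
theorem greedyPerm_of_some {a k : Fin n} (h : nextIndex π c t a = some k) :
    greedyPerm π c t a = greedyPerm π c t k * Equiv.swap a k := by
  rw [greedyPerm, greedyIndices]
  split
  · simp_all
  · rename_i k' h'
    obtain rfl : k' = k := by simpa [h'] using h
    rw [List.formPerm_cons_cons, mul_inv_rev, Equiv.swap_inv, ← mul_assoc]
    rfl

theorem nextIndex_eq_some {a k : Fin n} (h : nextIndex π c t a = some k) :
    (c ≤ k.val ∧ π a < π k ∧ (π k).val ≤ t) ∧
      ∀ p : Fin n, c ≤ p.val → p < k → ¬ (π a < π p ∧ (π p).val ≤ t) := by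
  refine ⟨by simpa using List.find?_some h, fun p hc hp hpt => ?_⟩
  rw [nextIndex, List.find?_eq_some_iff_getElem] at h
  obtain ⟨-, i, hi, rfl, hlt⟩ := h
  have hpi : p.val < i := by simpa [Fin.lt_def] using hp
  have := hlt p.val hpi
  simp only [List.getElem_finRange, Fin.cast_mk, Fin.eta, Bool.not_eq_true',
    decide_eq_false_iff_not] at this
  exact this ⟨hc, hpt⟩

theorem nextIndex_eq_none {a : Fin n} (h : nextIndex π c t a = none) (p : Fin n)
    (hc : c ≤ p.val) : ¬ (π a < π p ∧ (π p).val ≤ t) := by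
  have := List.find?_eq_none.1 h p (List.mem_finRange p)
  simp only [decide_eq_true_eq] at this
  exact fun h => this ⟨hc, h⟩

/-- The effect of the greedy algorithm, for a start `a` before which there are no candidates. -/
theorem greedyPerm_spec (τ : Fin n) (a : Fin n) (ha : π a ≤ τ)
    (hpos : ∀ p : Fin n, c ≤ p.val → p < a → ¬ (π a < π p ∧ π p ≤ τ))
    (hτ : c ≤ (π.symm τ).val ∨ π a = τ) :
    greedyPerm π c τ a a = τ ∧
    (∀ p : Fin n, p.val < c ∨ p < a → p ≠ a → greedyPerm π c τ a p = π p) ∧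
    ∀ L, c ≤ L → a.val < L → ∃ v ∈ firstEntries π L, π a ≤ v ∧ v ≤ τ ∧
      (∀ p : Fin n, c ≤ p.val → p.val < L → π p ≤ τ → π p ≤ v) ∧
      firstEntries (greedyPerm π c τ a) L = insert τ ((firstEntries π L).erase v) := by
  induction hN : n - (π a).val using Nat.strong_induction_on generalizing a with
  | _ N ih =>
  cases h : nextIndex π c τ a with
  | none =>
    have hnone := nextIndex_eq_none h
    -- The search cannot stop below `τ`, because the position of `τ` would still be a candidate.
    have hτa : π a = τ := by
      rcases hτ with hτ | hτ
      · by_contra hne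
        refine hnone _ hτ ⟨?_, by simp⟩
        simpa using lt_of_le_of_ne ha hne
      · exact hτ
    rw [greedyPerm_of_none h]
    refine ⟨hτa, fun _ _ _ => rfl, fun L hcL haL => ?_⟩
    have hmem : π a ∈ firstEntries π L := mem_firstEntries.2 ⟨a, haL, rfl⟩
    refine ⟨π a, hmem, le_rfl, ha, fun p hp _ hpτ => ?_, ?_⟩
    · by_contra! hlt
      exact hnone p hp ⟨hlt, hpτ⟩
    · rw [← hτa, Finset.insert_erase hmem]
  | some k =>
    obtain ⟨⟨hck, hak, hkτ⟩, hmin⟩ := nextIndex_eq_some h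
    have hkτ' : π k ≤ τ := hkτ
    have hlt : a < k := by
      rcases lt_trichotomy a k with h' | h' | h'
      · exact h'
      · subst h'; exact absurd hak (lt_irrefl _)
      · exact absurd ⟨hak, hkτ'⟩ (hpos k hck h')
    have hdec : n - (π k).val < N := by
      have := Fin.lt_def.1 hak
      have := (π k).isLt
      omega
    obtain ⟨h1, h2, h3⟩ := ih _ hdec k hkτ'
      (fun p hc hp hh => hmin p hc hp ⟨hak.trans hh.1, hh.2⟩) (by
        rcases hτ with hτ | hτ
        · exact Or.inl hτ
        · exact absurd (hak.trans_le hkτ') (by rw [hτ]; exact lt_irrefl _)) rfl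
    have hfix : ∀ p : Fin n, p.val < c ∨ p < k → p ≠ a → greedyPerm π c τ a p = π p := by
      intro p hp hpa
      have hpk : p ≠ k := by
        rintro rfl
        rcases hp with hp | hp
        · omega
        · exact lt_irrefl _ hp
      rw [greedyPerm_of_some h, Equiv.Perm.mul_apply, Equiv.swap_apply_of_ne_of_ne hpa hpk]
      exact h2 p hp hpk
    have hself : greedyPerm π c τ a a = τ := by
      rw [greedyPerm_of_some h, Equiv.Perm.mul_apply, Equiv.swap_apply_left, h1]
    refine ⟨hself, fun p hp hpa => hfix p (hp.imp_right fun hp => hp.trans hlt) hpa,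
      fun L hcL haL => ?_⟩
    -- If `k` is among the first `L` positions, the exchange of `a` and `k` preserves the prefix as
    -- a set and the claim for `k` applies. Otherwise `a` is the only changed position of the
    -- prefix, and minimality of `k` makes `π a` the replaced value `v`.
    by_cases hkL : k.val < L
    · obtain ⟨v, hv, hav, hvτ, hmax, himg⟩ := h3 L hcL hkL
      refine ⟨v, hv, hak.le.trans hav, hvτ, hmax, ?_⟩
      rw [← himg]
      ext x
      rw [mem_firstEntries, mem_firstEntries, greedyPerm_of_some h]
      have hsw : ∀ p : Fin n, p.val < L → (Equiv.swap a k p).val < L := by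
        intro p hp
        by_cases hpa : p = a
        · subst hpa; simpa using hkL
        · by_cases hpk : p = k
          · subst hpk; simpa using haL
          · rwa [Equiv.swap_apply_of_ne_of_ne hpa hpk]
      constructor
      · rintro ⟨p, hp, rfl⟩
        exact ⟨Equiv.swap a k p, hsw p hp, rfl⟩
      · rintro ⟨p, hp, rfl⟩
        exact ⟨Equiv.swap a k p, hsw p hp, by simp⟩
    · have hmem : π a ∈ firstEntries π L := mem_firstEntries.2 ⟨a, haL, rfl⟩
      refine ⟨π a, hmem, le_rfl, ha, fun p hp hpL hpτ => ?_, ?_⟩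
      · by_contra! hpa
        exact hmin p hp (Fin.lt_def.2 (by omega)) ⟨hpa, hpτ⟩
      · ext x
        rw [mem_firstEntries, Finset.mem_insert, Finset.mem_erase, mem_firstEntries]
        constructor
        · rintro ⟨p, hp, rfl⟩
          by_cases hpa : p = a
          · subst hpa; exact Or.inl hself
          · rw [hfix p (Or.inr (Fin.lt_def.2 (by omega))) hpa]
            exact Or.inr ⟨π.injective.ne hpa, p, hp, rfl⟩
        · rintro (rfl | ⟨hne, p, hp, rfl⟩)
          · exact ⟨a, haL, hself⟩
          · exact ⟨p, hp, hfix p (Or.inr (Fin.lt_def.2 (by omega))) fun h' => hne (by rw [h'])⟩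

/-- The set of the first `L` entries of `π`, as natural numbers. -/
def prefixSet (π : Equiv.Perm (Fin n)) (L : ℕ) : Finset ℕ :=
  (firstEntries π L).map Fin.valEmbedding

theorem mem_prefixSet {L v : ℕ} : v ∈ prefixSet π L ↔ ∃ p : Fin n, p.val < L ∧ (π p).val = v := by
  simp only [prefixSet, Finset.mem_map, mem_firstEntries, Fin.valEmbedding_apply]
  constructor
  · rintro ⟨_, ⟨p, hp, rfl⟩, rfl⟩
    exact ⟨p, hp, rfl⟩
  · rintro ⟨p, hp, rfl⟩
    exact ⟨_, ⟨p, hp, rfl⟩, rfl⟩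

theorem card_prefixSet {L : ℕ} (hL : L ≤ n) : (prefixSet π L).card = L := by
  rw [prefixSet, Finset.card_map, card_firstEntries π hL]

end Greedy

/-! ### Cells and columns of a tableau processed by the greedy algorithm -/

section Columns

variable {n : ℕ} {μ : YoungDiagram} (T : SemistandardYoungTableau μ)

theorem lt_rowLen_of_lt_colLen {i j : ℕ} (h : i < μ.colLen j) : j < μ.rowLen 0 :=
  YoungDiagram.mem_iff_lt_rowLen.1
    (μ.up_left_mem (Nat.zero_le i) le_rfl (YoungDiagram.mem_iff_lt_colLen.2 h))

theorem colLen_pos {j : ℕ} (h : j < μ.rowLen 0) : 0 < μ.colLen j :=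
  YoungDiagram.mem_iff_lt_colLen.1 (YoungDiagram.mem_iff_lt_rowLen.2 h)

theorem length_columnWord (j : ℕ) : (columnWord T j).length = μ.colLen j := by
  simp [columnWord]

theorem mem_columnWord {j x : ℕ} : x ∈ columnWord T j ↔ ∃ i < μ.colLen j, T i j = x := by
  simp [columnWord]

theorem pairwise_columnWord (j : ℕ) : (columnWord T j).Pairwise (· > ·) := by
  rw [columnWord, List.pairwise_reverse, List.pairwise_map]
  refine (List.pairwise_lt_range (n := μ.colLen j)).imp_of_mem fun {a b} _ hb hab => ?_
  exact T.col_strict hab (YoungDiagram.mem_iff_lt_colLen.2 (List.mem_range.1 hb))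

/-- Processing one cell replaces, in each long enough set of first entries, the largest element that
is at most the value of the cell. -/
theorem greedyStep_spec {j i : ℕ} {π : Equiv.Perm (Fin n)} (hn : μ.colLen j ≤ n)
    (hi : i < μ.colLen j) (hT : T i j < n)
    (hle : ∀ p : Fin n, p.val ≤ i → (π p).val ≤ T i j)
    (hmono : ∀ p q : Fin n, p < q → q.val ≤ i → π p < π q)
    (hgt : ∀ p : Fin n, i < p.val → p.val < μ.colLen j → T i j < (π p).val) :
    (∀ p : Fin n, p.val = i → (greedyStep T j i π p).val = T i j) ∧
    (∀ p : Fin n, p.val < μ.colLen j → p.val ≠ i → greedyStep T j i π p = π p) ∧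
    ∀ L, μ.colLen j ≤ L → ∃ v ∈ prefixSet π L, v ≤ T i j ∧
      (∀ x ∈ prefixSet π L, x ≤ T i j → x ≤ v) ∧
      prefixSet (greedyStep T j i π) L = insert (T i j) ((prefixSet π L).erase v) := by
  have hin : i < n := hi.trans_le hn
  have hstep : greedyStep T j i π = greedyPerm π (μ.colLen j) (T i j) ⟨i, hin⟩ := by
    rw [greedyStep, dif_pos hin]; rfl
  obtain ⟨h1, h2, h3⟩ := greedyPerm_spec (π := π) (c := μ.colLen j) ⟨T i j, hT⟩ ⟨i, hin⟩
    (Fin.le_def.2 (hle _ le_rfl))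
    (fun p hp hpi => absurd (Fin.lt_def.1 hpi) (by simp only; omega)) (by
      -- Among the first `μ.colLen j` positions, those before `i` have entries below `π i ≤ T i j`
      -- and those after `i` have entries above `T i j`; so `T i j` occurs there at most at `i`.
      by_contra! hne
      obtain ⟨hlt, hne⟩ := hne
      have hq : π (π.symm ⟨T i j, hT⟩) = ⟨T i j, hT⟩ := by simp
      set q := π.symm ⟨T i j, hT⟩ with hqdef
      rcases lt_trichotomy q.val i with h | h | h
      · have h4 := hmono q ⟨i, hin⟩ (Fin.lt_def.2 h) le_rfl
        have h5 := hle ⟨i, hin⟩ le_rfl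
        rw [hq, Fin.lt_def] at h4
        simp only at h4
        omega
      · exact hne (by rw [← hq]; congr 1; exact Fin.ext h.symm)
      · have h4 := hgt q h hlt
        rw [hq] at h4
        exact lt_irrefl _ h4)
  rw [hstep]
  refine ⟨?_, ?_, fun L hL => ?_⟩
  · rintro p rfl
    exact congrArg Fin.val h1
  · intro p hp hpi
    exact h2 p (Or.inl hp) fun h => hpi (congrArg Fin.val h)
  · obtain ⟨v, hv, hav, hvτ, hmax, himg⟩ := h3 L hL (hi.trans_le hL)
    refine ⟨v.val, Finset.mem_map_of_mem _ hv, hvτ, ?_, ?_⟩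
    · intro x hx hxt
      obtain ⟨p, hp, rfl⟩ := mem_prefixSet.1 hx
      by_cases hpc : p.val < μ.colLen j
      · rcases lt_trichotomy p.val i with h | h | h
        · exact ((hmono p ⟨i, hin⟩ (Fin.lt_def.2 h) le_rfl).le.trans hav)
        · obtain rfl : p = ⟨i, hin⟩ := Fin.ext h
          exact hav
        · exact absurd (hgt p h hpc) (by omega)
      · exact hmax p (by omega) hp hxt
    · have := congrArg (Finset.map Fin.valEmbedding) himg
      rwa [Finset.map_insert, Finset.map_erase] at this

/-- Processing one column inserts it into each long enough set of first entries. -/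
theorem foldr_greedyStep_spec {j : ℕ} {π : Equiv.Perm (Fin n)} (hn : μ.colLen j ≤ n)
    (hT : ∀ i < μ.colLen j, T i j < n)
    (hle : ∀ p : Fin n, p.val < μ.colLen j → (π p).val ≤ T p j)
    (hmono : ∀ p q : Fin n, p < q → q.val < μ.colLen j → π p < π q) :
    (∀ p : Fin n, p.val < μ.colLen j →
      ((List.range (μ.colLen j)).foldr (greedyStep T j) π p).val = T p j) ∧
    ∀ L, μ.colLen j ≤ L → ∃ ms, Bumps (prefixSet π L) (columnWord T j) ms
      (prefixSet ((List.range (μ.colLen j)).foldr (greedyStep T j) π) L) := by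
  -- the lowest `d` cells have been processed
  suffices h : ∀ c, c ≤ μ.colLen j → ∀ π : Equiv.Perm (Fin n),
      (∀ p : Fin n, p.val < c → (π p).val ≤ T p j) →
      (∀ p q : Fin n, p < q → q.val < c → π p < π q) →
      (∀ p : Fin n, c ≤ p.val → p.val < μ.colLen j → (π p).val = T p j) →
      (∀ p : Fin n, p.val < μ.colLen j →
        ((List.range c).foldr (greedyStep T j) π p).val = T p j) ∧
      ∀ L, μ.colLen j ≤ L → ∃ ms, Bumps (prefixSet π L)
        ((List.range c).map fun i => T i j).reverse ms
        (prefixSet ((List.range c).foldr (greedyStep T j) π) L) by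
    exact h _ le_rfl π hle hmono fun p h1 h2 => absurd h1 (by omega)
  intro c
  induction c with
  | zero =>
    intro _ π _ _ heq
    exact ⟨fun p hp => heq p (Nat.zero_le _) hp, fun L _ => ⟨[], Bumps.nil _⟩⟩
  | succ c ih =>
    intro hc π hle hmono heq
    have hcell : ∀ i < μ.colLen j, (i, j) ∈ μ := fun i hi => YoungDiagram.mem_iff_lt_colLen.2 hi
    obtain ⟨h1, h2, h3⟩ := greedyStep_spec T hn (i := c) (π := π) (by omega) (hT c (by omega))
      (fun p hp => (hle p (by omega)).trans (T.col_weak hp (hcell c (by omega))))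
      (fun p q hpq hq => hmono p q hpq (by omega))
      (fun p hp hpj => by
        rw [heq p hp hpj]
        exact T.col_strict hp (hcell _ hpj))
    obtain ⟨h4, h5⟩ := ih (by omega) (greedyStep T j c π)
      (fun p hp => by rw [h2 p (by omega) (by omega)]; exact hle p (by omega))
      (fun p q hpq hq => by
        rw [Fin.lt_def] at hpq
        rw [h2 p (by omega) (by omega), h2 q (by omega) (by omega)]
        exact hmono p q hpq (by omega))
      (fun p hp hpj => by
        rcases hp.eq_or_lt with h | h
        · rw [h1 p h.symm, h]
        · rw [h2 p hpj (by omega)]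
          exact heq p h hpj)
    -- `foldr` over `List.range` treats the lowest cell first, which is the order in which
    -- `columnWord` reads the column.
    simp only [List.range_succ, List.foldr_append, List.foldr_cons, List.foldr_nil, List.map_append,
      List.map_cons, List.map_nil, List.reverse_append, List.reverse_cons, List.reverse_nil,
      List.nil_append, List.cons_append]
    refine ⟨h4, fun L hL => ?_⟩
    obtain ⟨v, hv, hvt, hmax, himg⟩ := h3 L hL
    obtain ⟨ms, hms⟩ := h5 L hL
    rw [himg] at hms
    exact ⟨v :: ms, Bumps.cons hv hvt hmax hms⟩

end Columns

/-! ### Frank words and the right key -/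

section Frank

variable {n : ℕ} {μ : YoungDiagram} (T : SemistandardYoungTableau μ)

theorem card_colValues (hT : ∀ i j : ℕ, (i, j) ∈ μ → T i j < n) (j : ℕ) :
    (colValues n T j).card = μ.colLen j := by
  have h : (colValues n T j).map Fin.valEmbedding = (columnWord T j).toFinset := by
    ext x
    simp only [colValues, Finset.mem_map, Finset.mem_filter, Finset.mem_univ, true_and,
      Fin.valEmbedding_apply, List.mem_toFinset, mem_columnWord]
    constructor
    · rintro ⟨v, ⟨i, hi, h⟩, rfl⟩
      exact ⟨i, hi, h⟩
    · rintro ⟨i, hi, rfl⟩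
      exact ⟨⟨T i j, hT i j (YoungDiagram.mem_iff_lt_colLen.2 hi)⟩, ⟨i, hi, rfl⟩, rfl⟩
  rw [← Finset.card_map Fin.valEmbedding, h,
    List.toFinset_card_of_nodup ((pairwise_columnWord T j).imp fun h => h.ne'), length_columnWord]

theorem listFirst_apply (s : Finset (Fin n)) (p : Fin n) (hp : p.val < s.card) :
    listFirst s p = s.orderEmbOfFin rfl ⟨p, hp⟩ := by
  have h : finSumFinEquiv.symm (finCongr (show n = s.card + sᶜ.card by
      rw [Finset.card_add_card_compl, Fintype.card_fin]) p) = Sum.inl ⟨p, hp⟩ := by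
    rw [Equiv.symm_apply_eq]
    exact Fin.ext rfl
  simp only [listFirst, Equiv.trans_apply, h, finSumEquivOfFinset_inl]

/-- Row and column conditions of `T` turn this statement for column `j` into the hypotheses of
`foldr_greedyStep_spec` for column `j + 1`. -/
theorem alcovePermUpTo_apply (hμ : μ.colLen 0 ≤ n) (hT : ∀ i j : ℕ, (i, j) ∈ μ → T i j < n)
    (j : ℕ) : ∀ p : Fin n, p.val < μ.colLen j → (alcovePermUpTo n T j p).val = T p j := by
  induction j with
  | zero =>
    intro p hp
    have hcard := card_colValues T hT 0
    have hcell : ∀ i : Fin (colValues n T 0).card, (i.val, 0) ∈ μ := fun i =>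
      YoungDiagram.mem_iff_lt_colLen.2 (i.isLt.trans_eq hcard)
    rw [alcovePermUpTo, listFirst_apply _ p (by rwa [hcard]), ← Finset.orderEmbOfFin_unique rfl
      (f := fun i => (⟨T i 0, hT i 0 (hcell i)⟩ : Fin n))]
    · intro i
      simp only [colValues, Finset.mem_filter, Finset.mem_univ, true_and]
      exact ⟨i, i.isLt.trans_eq hcard, rfl⟩
    · intro i i' h
      exact Fin.lt_def.2 (T.col_strict (Fin.lt_def.1 h) (hcell i'))
  | succ j ih =>
    have hle : μ.colLen (j + 1) ≤ μ.colLen j := μ.colLen_anti _ _ (Nat.le_succ j)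
    refine (foldr_greedyStep_spec T (colLen_le_of_colLen_zero_le hμ _)
      (fun i hi => hT _ _ (YoungDiagram.mem_iff_lt_colLen.2 hi)) (fun p hp => ?_)
      (fun p q hpq hq => ?_)).1
    · rw [ih p (by omega)]
      exact T.row_weak (Nat.lt_succ_self j) (YoungDiagram.mem_iff_lt_colLen.2 hp)
    · rw [Fin.lt_def, ih p (by have := Fin.lt_def.1 hpq; omega), ih q (by omega)]
      exact T.col_strict hpq (YoungDiagram.mem_iff_lt_colLen.2 (by omega))

theorem exists_bumps_alcovePermUpTo (hμ : μ.colLen 0 ≤ n)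
    (hT : ∀ i j : ℕ, (i, j) ∈ μ → T i j < n) (j L : ℕ) (hL : μ.colLen (j + 1) ≤ L) :
    ∃ ms, Bumps (prefixSet (alcovePermUpTo n T j) L) (columnWord T (j + 1)) ms
      (prefixSet (alcovePermUpTo n T (j + 1)) L) := by
  have hle : μ.colLen (j + 1) ≤ μ.colLen j := μ.colLen_anti _ _ (Nat.le_succ j)
  have ih := alcovePermUpTo_apply T hμ hT j
  refine (foldr_greedyStep_spec T (colLen_le_of_colLen_zero_le hμ _)
    (fun i hi => hT _ _ (YoungDiagram.mem_iff_lt_colLen.2 hi)) (fun p hp => ?_)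
    (fun p q hpq hq => ?_)).2 L hL
  · rw [ih p (by omega)]
    exact T.row_weak (Nat.lt_succ_self j) (YoungDiagram.mem_iff_lt_colLen.2 hp)
  · rw [Fin.lt_def, ih p (by have := Fin.lt_def.1 hpq; omega), ih q (by omega)]
    exact T.col_strict hpq (YoungDiagram.mem_iff_lt_colLen.2 (by omega))

theorem decWord_prefixSet_alcovePermUpTo (hμ : μ.colLen 0 ≤ n)
    (hT : ∀ i j : ℕ, (i, j) ∈ μ → T i j < n) (j : ℕ) :
    decWord (prefixSet (alcovePermUpTo n T j) (μ.colLen j)) = columnWord T j := by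
  refine (eq_decWord (pairwise_columnWord T j) fun x => ?_).symm
  rw [mem_columnWord, mem_prefixSet]
  have h := alcovePermUpTo_apply T hμ hT j
  constructor
  · rintro ⟨i, hi, rfl⟩
    exact ⟨⟨i, hi.trans_le (colLen_le_of_colLen_zero_le hμ j)⟩, hi, h _ hi⟩
  · rintro ⟨p, hp, rfl⟩
    exact ⟨p, hp, (h p hp).symm⟩

/-- Two successive columns of a word are not parts of one column factor. -/
def WeakBoundary (D E : List ℕ) : Prop :=
  ∃ x ∈ D, ∃ y ∈ E, x ≤ y

/-- The last letter of a decreasing column is its smallest and the first its largest, so any pair `x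
≤ y` across a boundary forces a break there. -/
theorem columnFactors_flatten {Ds : List (List ℕ)} (hDs : ∀ D ∈ Ds, D.Pairwise (· > ·))
    (hne : [] ∉ Ds) (hchain : Ds.IsChain WeakBoundary) : columnFactors Ds.flatten = Ds := by
  have hchain' := List.isChain_iff_forall_rel_of_append_cons_cons.1 hchain
  refine List.splitBy_flatten hne (fun D hD => ?_)
    (List.isChain_iff_forall_rel_of_append_cons_cons.2 fun D E l₁ l₂ h => ?_)
  · exact (hDs D hD).isChain.imp fun a b h => by simpa using h
  · obtain ⟨x, hx, y, hy, hxy⟩ := hchain' h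
    have hD := hDs D (by simp [h])
    have hE := hDs E (by simp [h])
    refine ⟨List.ne_nil_of_mem hx, List.ne_nil_of_mem hy, ?_⟩
    have h1 : D.getLast (List.ne_nil_of_mem hx) ≤ x := by
      obtain ⟨l, z, rfl⟩ := List.eq_nil_or_concat D |>.resolve_left (List.ne_nil_of_mem hx)
      simp only [List.concat_eq_append] at hD hx ⊢
      rw [List.getLast_append_singleton]
      rcases List.mem_append.1 hx with hx | hx
      · exact ((List.pairwise_append.1 hD).2.2 x hx z (by simp)).le
      · exact (List.mem_singleton.1 hx).ge
    have h2 : y ≤ E.head (List.ne_nil_of_mem hy) := by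
      cases E with
      | nil => simp at hy
      | cons z l =>
        rcases List.mem_cons.1 hy with rfl | hy
        · exact le_rfl
        · exact ((List.pairwise_cons.1 hE).1 y hy).le
    simp only [decide_eq_false_iff_not, not_lt]
    omega

/-- A word that ends in the column of the first `μ.colLen l` entries of the permutation reached
after column `l + d`, and is equivalent to the first `l + d + 1` columns of `T`. -/
theorem exists_columns (hμ : μ.colLen 0 ≤ n) (hT : ∀ i j : ℕ, (i, j) ∈ μ → T i j < n)
    (l d : ℕ) (hd : l + d < μ.rowLen 0) :
    ∃ Ds : List (List ℕ), (∀ D ∈ Ds, D.Pairwise (· > ·)) ∧ Ds.IsChain WeakBoundary ∧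
      (∀ D ∈ Ds.getLast?, ∃ x ∈ D, x ≤ T 0 (l + d)) ∧
      T 0 (l + d) ∈ prefixSet (alcovePermUpTo n T (l + d)) (μ.colLen l) ∧
      (Ds.map List.length ++ [μ.colLen l]).Perm ((List.range (l + d + 1)).map μ.colLen) ∧
      KnuthEquiv (Ds.flatten ++ decWord (prefixSet (alcovePermUpTo n T (l + d)) (μ.colLen l)))
        ((List.range (l + d + 1)).map fun j => columnWord T j).flatten := by
  have hmem : ∀ j < μ.rowLen 0, T 0 j ∈ columnWord T j := fun j hj =>
    (mem_columnWord T).2 ⟨0, colLen_pos hj, rfl⟩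
  have hrow : ∀ j j', j ≤ j' → j' < μ.rowLen 0 → T 0 j ≤ T 0 j' := fun j j' hj hj' =>
    T.row_weak_of_le hj (YoungDiagram.mem_iff_lt_rowLen.2 hj')
  induction d with
  | zero =>
    simp only [Nat.add_zero] at hd ⊢
    have hdec := decWord_prefixSet_alcovePermUpTo T hμ hT l
    refine ⟨(List.range l).map fun j => columnWord T j, ?_, ?_, ?_, ?_, ?_, ?_⟩
    · intro D hD
      obtain ⟨j, -, rfl⟩ := List.mem_map.1 hD
      exact pairwise_columnWord T j
    · refine List.Pairwise.isChain (List.pairwise_map.2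
        ((List.pairwise_lt_range (n := l)).imp_of_mem fun {a b} ha hb hab => ?_))
      have hb' := List.mem_range.1 hb
      exact ⟨_, hmem a (by omega), _, hmem b (by omega), hrow a b hab.le (by omega)⟩
    · intro D hD
      obtain ⟨j, hj, rfl⟩ := List.mem_map.1 (List.mem_of_getLast? hD)
      have hj' := List.mem_range.1 hj
      exact ⟨_, hmem j (by omega), hrow j l hj'.le hd⟩
    · rw [← mem_decWord, hdec]
      exact hmem l hd
    · rw [List.range_succ, List.map_append, List.map_map]
      simp [Function.comp_def, length_columnWord]
    · rw [hdec, List.range_succ, List.map_append, List.flatten_append]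
      simpa using KnuthEquiv.refl _
  | succ d ih =>
    obtain ⟨Ds, h1, h2, h3, h4, h5, h6⟩ := ih (by omega)
    simp only [← Nat.add_assoc] at hd ⊢
    obtain ⟨ms, hms⟩ := exists_bumps_alcovePermUpTo T hμ hT (l + d) (μ.colLen l)
      (μ.colLen_anti _ _ (by omega))
    have hdecr := pairwise_columnWord T (l + d + 1)
    have hTm := hmem _ hd
    -- The next column of `T` is inserted into the final column; the replaced letters `ms` become a
    -- new column in front of it. The top entry `T 0 (l + d)` mediates the weak boundary between the
    -- preceding column and `ms`.
    refine ⟨Ds ++ [ms], ?_, ?_, ?_, ?_, ?_, ?_⟩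
    · intro D hD
      rcases List.mem_append.1 hD with hD | hD
      · exact h1 D hD
      · rw [List.mem_singleton.1 hD]
        exact hms.pairwise hdecr
    · refine List.isChain_append.2 ⟨h2, List.isChain_singleton _, fun D hD E hE => ?_⟩
      obtain rfl : ms = E := by simpa using hE
      obtain ⟨x, hx, hxT⟩ := h3 D hD
      obtain ⟨y, hy, hTy⟩ := hms.exists_ge hdecr h4 hTm (hrow _ _ (Nat.le_succ _) hd)
      exact ⟨x, hx, y, hy, hxT.trans hTy⟩
    · intro D hD
      obtain rfl : ms = D := by simpa using hD
      exact hms.exists_le hTm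
    · exact hms.mem_right hdecr hTm
    · rw [List.range_succ, List.map_append, List.map_append]
      have h7 : ms.length = μ.colLen (l + d + 1) := by rw [hms.length_eq, length_columnWord]
      simp only [List.map_cons, List.map_nil, h7]
      rw [List.append_assoc]
      refine (List.Perm.append_left _ List.perm_append_comm).trans ?_
      rw [← List.append_assoc]
      exact h5.append_right _
    · rw [List.range_succ, List.map_append, List.flatten_append, List.flatten_append]
      have h8 := hms.knuthEquiv.append_left Ds.flatten
      have h9 := h6.append_right (columnWord T (l + d + 1))
      simp only [List.map_cons, List.map_nil, List.flatten_cons, List.flatten_nil, List.append_nil,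
        List.append_assoc] at h8 h9 ⊢
      exact h8.symm.trans h9

/-- The letter in row `i` goes to sequence `i`, and rows from `k` on are skipped. -/
theorem exists_run_column {k : ℕ} {s : Fin k → ℕ} (j c : ℕ) (hc : c ≤ μ.colLen j)
    (hs : ∀ i : Fin k, i.val < c → s i ≤ T i j) :
    ∃ t : Fin k → ℕ, Run s ((List.range c).map fun i => T i j).reverse (min c k) t ∧
      ∀ i : Fin k, i.val < c → t i = T i j := by
  -- The added clause is needed because the lowest letter is read first and its sequence must
  -- survive the rest of the column.
  suffices h : ∃ t : Fin k → ℕ, Run s ((List.range c).map fun i => T i j).reverse (min c k) t ∧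
      (∀ i : Fin k, i.val < c → t i = T i j) ∧ ∀ i : Fin k, c ≤ i.val → t i = s i from
    h.imp fun t ht => ⟨ht.1, ht.2.1⟩
  induction c generalizing s with
  | zero => exact ⟨s, by simpa using Run.nil s, by simp, by simp⟩
  | succ c ih =>
    simp only [List.range_succ, List.map_append, List.map_cons, List.map_nil, List.reverse_append,
      List.reverse_cons, List.reverse_nil, List.nil_append, List.cons_append]
    by_cases hck : c < k
    · obtain ⟨t, h1, h2, h3⟩ := ih (s := Function.update s ⟨c, hck⟩ (T c j)) (by omega)
        (fun i hi => by
          have : i ≠ ⟨c, hck⟩ := fun h => by simp [h] at hi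
          rw [Function.update_of_ne this]
          exact hs i (by omega))
      refine ⟨t, ?_, fun i hi => ?_, fun i hi => ?_⟩
      · have e : min (c + 1) k = min c k + 1 := by omega
        rw [e]
        exact Run.use _ ⟨c, hck⟩ (hs ⟨c, hck⟩ (Nat.lt_succ_self c)) h1
      · rcases (Nat.lt_succ_iff.1 hi).lt_or_eq with h | h
        · exact h2 i h
        · rw [h3 i h.ge]
          obtain rfl : i = ⟨c, hck⟩ := Fin.ext h
          simp
      · have : i ≠ ⟨c, hck⟩ := fun h => by simp [h] at hi
        rw [h3 i (by omega), Function.update_of_ne this]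
    · obtain ⟨t, h1, h2, h3⟩ := ih (s := s) (by omega) (fun i hi => hs i (by omega))
      refine ⟨t, ?_, fun i hi => h2 i (by omega), fun i hi => h3 i (by omega)⟩
      have e : min (c + 1) k = min c k := by omega
      rw [e]
      exact Run.skip _ h1

/-- The first `k` rows of a tableau are disjoint weakly increasing subsequences of its word. -/
theorem canRun_tableauWord (k : ℕ) : CanRun (fun _ : Fin k => 0) (tableauWord T)
    ((List.range (μ.rowLen 0)).map fun j => min (μ.colLen j) k).sum := by
  suffices h : ∀ r, ∃ t : Fin k → ℕ, Run (fun _ : Fin k => 0)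
      ((List.range r).map fun j => columnWord T j).flatten
      ((List.range r).map fun j => min (μ.colLen j) k).sum t ∧
      ∀ i : Fin k, i.val < μ.colLen r → t i ≤ T i r from (h _).imp fun _ ht => ht.1
  intro r
  induction r with
  | zero => exact ⟨_, Run.nil _, fun _ _ => Nat.zero_le _⟩
  | succ r ih =>
    obtain ⟨t, h1, h2⟩ := ih
    obtain ⟨t', h3, h4⟩ := exists_run_column T r _ le_rfl h2
    change Run t (columnWord T r) _ t' at h3
    refine ⟨t', ?_, fun i hi => ?_⟩
    · rw [List.range_succ, List.map_append, List.map_append, List.flatten_append, List.sum_append]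
      simpa using run_append h1 h3
    · rw [h4 i (hi.trans_le (μ.colLen_anti _ _ (Nat.le_succ r)))]
      exact T.row_weak (Nat.lt_succ_self r) (YoungDiagram.mem_iff_lt_colLen.2 hi)

theorem pairwise_of_mem_columnFactors {w D : List ℕ} (h : D ∈ columnFactors w) :
    D.Pairwise (· > ·) :=
  List.isChain_iff_pairwise.1 ((List.isChain_of_mem_splitBy h).imp fun a b h => by simpa using h)

/-- Frank words for one tableau whose last column factors have equal lengths end in the same
column factor. -/
theorem IsFrankWordFor.last_eq {T : SemistandardYoungTableau μ} {w w' C C' : List ℕ}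
    (hw : IsFrankWordFor T w) (hw' : IsFrankWordFor T w')
    (hC : (columnFactors w).getLast? = some C) (hC' : (columnFactors w').getLast? = some C')
    (hlen : C.length = C'.length) : C = C' := by
  obtain ⟨Ds, hDs⟩ := List.getLast?_eq_some_iff.1 hC
  obtain ⟨Ds', hDs'⟩ := List.getLast?_eq_some_iff.1 hC'
  have e : w = Ds.flatten ++ C := by
    rw [← List.flatten_splitBy (fun a b => decide (b < a)) w]
    change (columnFactors w).flatten = _
    rw [hDs]; simp
  have e' : w' = Ds'.flatten ++ C' := by
    rw [← List.flatten_splitBy (fun a b => decide (b < a)) w']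
    change (columnFactors w').flatten = _
    rw [hDs']; simp
  have hp : ∀ D ∈ Ds ++ [C], D.Pairwise (· > ·) := fun D hD =>
    pairwise_of_mem_columnFactors (hDs ▸ hD)
  have hp' : ∀ D ∈ Ds' ++ [C'], D.Pairwise (· > ·) := fun D hD =>
    pairwise_of_mem_columnFactors (hDs' ▸ hD)
  have hperm := hw.2
  have hperm' := hw'.2
  rw [hDs, List.map_append] at hperm
  rw [hDs', List.map_append] at hperm'
  simp only [List.map_cons, List.map_nil] at hperm hperm'
  refine KnuthEquiv.last_column_eq (Ds := Ds) (Ds' := Ds')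
    (fun D hD => hp D (List.mem_append_left _ hD)) (fun D hD => hp' D (List.mem_append_left _ hD))
    (hp C (by simp)) (hp' C' (by simp)) hlen ?_ ?_ ?_
  · rw [← hlen] at hperm'
    exact (List.perm_append_right_iff _).1 (hperm.trans hperm'.symm)
  · rw [← e, ← e']
    exact hw.1.trans hw'.1.symm
  -- The rows of `T` supply the maximum, and rearranging the column lengths does not change the sum
  -- of the minima.
  · rw [← e, hw.1.canRun_iff]
    have h := canRun_tableauWord T C.length
    have hs := (hperm.map fun l => min l C.length).sum_eq
    simp only [List.map_append, List.map_map, List.map_cons, List.map_nil, List.sum_append,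
      List.sum_cons, List.sum_nil, Function.comp_def, min_self, add_zero] at hs
    rwa [hs]

theorem columnWord_permKey (hμ : μ.colLen 0 ≤ n) (φ : Equiv.Perm (Fin n)) (j : ℕ) :
    columnWord (permKey hμ φ) j = decWord (prefixSet φ (μ.colLen j)) := by
  refine eq_decWord (pairwise_columnWord _ j) fun x => ?_
  have hcard := card_firstEntries φ (colLen_le_of_colLen_zero_le hμ j)
  have hentry : ∀ i (hi : i < μ.colLen j), permKey hμ φ i j =
      ((firstEntries φ (μ.colLen j)).orderEmbOfFin hcard ⟨i, hi⟩).val := fun i hi =>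
    dif_pos (YoungDiagram.mem_iff_lt_colLen.2 hi)
  rw [mem_columnWord, prefixSet, Finset.mem_map]
  constructor
  · rintro ⟨i, hi, rfl⟩
    rw [hentry i hi]
    exact ⟨_, Finset.orderEmbOfFin_mem _ _ _, rfl⟩
  · rintro ⟨v, hv, rfl⟩
    rw [← Finset.mem_coe, ← Finset.range_orderEmbOfFin _ hcard] at hv
    obtain ⟨i, rfl⟩ := hv
    exact ⟨i, i.isLt, hentry i i.isLt⟩

theorem isKey_permKey (hμ : μ.colLen 0 ≤ n) (φ : Equiv.Perm (Fin n)) : IsKey (permKey hμ φ) := by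
  intro i j hij
  have h1 : permKey hμ φ i (j + 1) ∈ columnWord (permKey hμ φ) (j + 1) :=
    (mem_columnWord _).2 ⟨i, YoungDiagram.mem_iff_lt_colLen.1 hij, rfl⟩
  have h2 : permKey hμ φ i (j + 1) ∈ columnWord (permKey hμ φ) j := by
    rw [columnWord_permKey, mem_decWord] at h1 ⊢
    exact Finset.map_subset_map.2 (firstEntries_mono φ (μ.colLen_anti _ _ (Nat.le_succ j))) h1
  obtain ⟨i', hi', h⟩ := (mem_columnWord _).1 h2
  exact ⟨i', YoungDiagram.mem_iff_lt_colLen.2 hi', h⟩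

/-- For each column there is a frank word ending in this column of the key of the final
permutation. -/
theorem exists_isFrankWordFor (hμ : μ.colLen 0 ≤ n) (hT : ∀ i j : ℕ, (i, j) ∈ μ → T i j < n)
    {j : ℕ} (hj : j < μ.rowLen 0) : ∃ w, IsFrankWordFor T w ∧
      (columnFactors w).getLast? = some (columnWord (permKey hμ (alcovePerm n T)) j) := by
  obtain ⟨Ds, h1, h2, h3, h4, h5, h6⟩ := exists_columns T hμ hT j (μ.rowLen 0 - 1 - j) (by omega)
  have e : j + (μ.rowLen 0 - 1 - j) = μ.rowLen 0 - 1 := by omega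
  have e' : μ.rowLen 0 - 1 + 1 = μ.rowLen 0 := by omega
  rw [e] at h3 h4
  rw [e, e'] at h5 h6
  rw [columnWord_permKey]
  change T 0 _ ∈ prefixSet (alcovePerm n T) _ at h4
  change KnuthEquiv (_ ++ decWord (prefixSet (alcovePerm n T) _)) _ at h6
  set A := prefixSet (alcovePerm n T) (μ.colLen j) with hA
  have hcard : A.card = μ.colLen j := card_prefixSet (colLen_le_of_colLen_zero_le hμ j)
  have hlen : ((Ds ++ [decWord A]).map List.length).Perm
      ((List.range (μ.rowLen 0)).map μ.colLen) := by
    simpa [length_decWord, hcard] using h5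
  have hfac : columnFactors (Ds ++ [decWord A]).flatten = Ds ++ [decWord A] := by
    refine columnFactors_flatten ?_ (fun h => ?_) ?_
    · intro D hD
      rcases List.mem_append.1 hD with hD | hD
      · exact h1 D hD
      · rw [List.mem_singleton.1 hD]
        exact pairwise_decWord A
    · have h0 := hlen.mem_iff.1 (List.mem_map_of_mem (f := List.length) h)
      obtain ⟨l, hl, h0⟩ := List.mem_map.1 h0
      have := colLen_pos (List.mem_range.1 hl)
      simp only [List.length_nil] at h0
      omega
    · refine List.isChain_append.2 ⟨h2, List.isChain_singleton _, fun D hD E hE => ?_⟩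
      obtain rfl : decWord A = E := by simpa using hE
      obtain ⟨x, hx, hxT⟩ := h3 D hD
      exact ⟨x, hx, _, mem_decWord.2 h4, hxT⟩
  refine ⟨(Ds ++ [decWord A]).flatten, ⟨by simpa [tableauWord] using h6, by rwa [hfac]⟩, ?_⟩
  rw [hfac]
  simp

theorem isRightKey_permKey_alcovePerm (hμ : μ.colLen 0 ≤ n)
    (hT : ∀ i j : ℕ, (i, j) ∈ μ → T i j < n) :
    IsRightKey T (permKey hμ (alcovePerm n T)) := by
  refine ⟨isKey_permKey hμ _, fun j hj C => ?_⟩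
  obtain ⟨w₀, hw₀, hlast⟩ := exists_isFrankWordFor T hμ hT hj
  constructor
  · rintro ⟨w, hw, hC, hlen⟩
    exact hw.last_eq hw₀ hC hlast (by rw [hlen, length_columnWord])
  · rintro rfl
    exact ⟨w₀, hw₀, hlast, length_columnWord _ j⟩

/-- Each column of `K` is the last column factor of some frank word, hence a column of `K'`. -/
theorem IsRightKey.unique {T K K' : SemistandardYoungTableau μ} (h : IsRightKey T K)
    (h' : IsRightKey T K') : K = K' := by
  refine SemistandardYoungTableau.ext fun i j => ?_
  by_cases hij : (i, j) ∈ μ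
  · have hi := YoungDiagram.mem_iff_lt_colLen.1 hij
    have hj := lt_rowLen_of_lt_colLen hi
    have e : columnWord K j = columnWord K' j :=
      (h'.2 j hj _).1 ((h.2 j hj _).2 rfl)
    have e' := List.map_inj_left.1 (List.reverse_injective e)
    exact e' i (List.mem_range.2 hi)
  · rw [K.zeros hij, K'.zeros hij]

end Frank

end AlcoveKey

/-- For a partition `μ` with at most `n` rows and a semistandard tableau `T` of shape `μ` with values
in `{0, …, n - 1}`, the right key of `T` is well defined and it is the `μ`-key of `π_T`. -/
theorem corollary5p5 (n : ℕ) (μ : YoungDiagram) (hμ : μ.colLen 0 ≤ n)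
    (T : SemistandardYoungTableau μ) (hT : ∀ i j : ℕ, (i, j) ∈ μ → T i j < n) :
    (∃! K : SemistandardYoungTableau μ, AlcoveKey.IsRightKey T K) ∧
      AlcoveKey.permKey hμ (AlcoveKey.alcovePerm n T) = AlcoveKey.rightKey T := by
  have h := AlcoveKey.isRightKey_permKey_alcovePerm T hμ hT
  exact ⟨⟨_, h, fun K hK => hK.unique h⟩, h.unique (Classical.epsilon_spec ⟨_, h⟩)⟩
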